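/- **Theorem (Conditional Delta-Method).** Let $(\mathbb D,\|\cdot\|_{\mathbb D})$, $(\mathbb E,\|\cdot\|_{\mathbb E})$ be real normed spaces, let $(\Omega_1\times\Omega_2,\mathcal A_1\otimes\mathcal A_2,Q_1\otimes Q_2)$ be a product probability space, and let $X_n:\Omega_1\to\chi_{1n}$, $M_n:\Omega_2\to\chi_{2n}$, $n\in\mathbb N$, be arbitrary (possibly nonmeasurable) maps into arbitrary sets. *Definitions.* For a bounded real function $f$ on a probability space, $f^*$ denotes its minimal measurable majorant, $f_*=-(-f)^*$ its maximal measurable minorant (both unique almost surely), and $\mathrm E^*f=\mathrm E f^*$ its outer expectation. Maps $Y_n$ from a probability space to a metric space $\mathbb S$ satisfy $Y_n\rightsquigarrow Z$ if $\mathrm E^*f(Y_n)\to \mathrm Ef(Z)$ for every bounded continuous $f:\mathbb S\to\mathbb R$. A Borel measurable random element is separable if it lies almost surely in a separable measurable set. Real functions $Z_n$ on $\Omega_1$ converge to $0$ in outer probability if $Q_1^*(|Z_n|\ge\varepsilon)\to0$ for every $\varepsilon>0$, where $Q_1^*$ is the outer measure. Let $BL_1(\mathbb S)$ be the set of all $h:\mathbb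 S\to[-1,1]$ with $|h(x)-h(y)|\le d(x,y)$ for all $x,y$. For maps $y_n:\chi_{1n}\times\chi_{2n}\to\mathbb S$ and a separable Borel measurable $Y:\Omega_1\times\Omega_2\to\mathbb S$, we say that $y_n(X_n,M_n)\rightsquigarrow Y$ *conditionally on $X_n$ in outer probability* if $$\sup_{h\in BL_1(\mathbb S)}\bigl|\mathrm E_2\,h(y_n(X_n,M_n))^{2*}-\mathrm E\,h(Y)\bigr|\to0\quad\text{in outer probability},$$ $$\mathrm E_2\,h(y_n(X_n,M_n))^{*}-\mathrm E_2\,h(y_n(X_n,M_n))_{*}\to0\quad\text{in outer probability, for every }h\in BL_1(\mathbb S).$$ Here $\mathrm E_2$ is the integral with respect to $Q_2$ over $\omega_2\in\Omega_2$ for fixed $\omega_1\in\Omega_1$; ${}^*$ and ${}_*$ are taken jointly on $(\Omega_1\times\Omega_2,\mathcal A_1\otimes\mathcal A_2,Q_1\otimes Q_2)$, and ${}^{2*}$ is the minimal measurable majorant on $(\Omega_2,\mathcal A_2,Q_2)$ for fixed $\omega_1$. A map $\phi:\mathbb D_\phi\subset\mathbb D\to\mathbb E$ is *uniformly Hadamard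 differentiable* at $\theta\in\mathbb D_\phi$ tangentially to a linear subspace $\mathbb D_0\subset\mathbb D$, with derivative $\phi'_\theta$, if $\phi'_\theta:\mathbb D_0\to\mathbb E$ is continuous and linear and $$t_n^{-1}\bigl(\phi(\theta_n+t_nh_n)-\phi(\theta_n)\bigr)\to\phi'_\theta(h)$$ for all real $t_n\to0$ with $t_n\neq0$, all $h_n\to h\in\mathbb D_0$ in $\mathbb D$, and all $\theta_n\to\theta$ with $\theta_n,\ \theta_n+t_nh_n\in\mathbb D_\phi$ for all $n$. *Statement.* Let $\phi:\mathbb D_\phi\subset\mathbb D\to\mathbb E$ be uniformly Hadamard differentiable at $P\in\mathbb D_\phi$ tangentially to a linear subspace $\mathbb D_0\subset\mathbb D$, with derivative $\phi'_P$. Let $r_n\to\infty$ be real constants and let $P_n\in\mathbb D_\phi$ with $P_n\to P$. Let $\mathbb P_n=\mathbb P_n(X_n):\Omega_1\to\mathbb D_\phi$ be maps with $r_n(\mathbb P_n-P_n)\rightsquigarrow\mathbb G$ in $\mathbb D$ for some separable Borel measurable $\mathbb G:\Omega_1\to\mathbb D_0$. Let $\widehat{\mathbb P}_n=\widehat{\mathbb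 P}_n(X_n,M_n):\Omega_1\times\Omega_2\to\mathbb D_\phi$ be maps with $r_n(\widehat{\mathbb P}_n-\mathbb P_n)\rightsquigarrow\widehat{\mathbb G}$ in $\mathbb D$ conditionally on $X_n$ in outer probability for some separable Borel measurable $\widehat{\mathbb G}:\Omega_1\times\Omega_2\to\mathbb D_0$. Then $$r_n\bigl(\phi(\widehat{\mathbb P}_n)-\phi(\mathbb P_n)\bigr)\rightsquigarrow\phi'_P(\widehat{\mathbb G})\quad\text{in }\mathbb E\text{ conditionally on }X_n\text{ in outer probability.}$$ -/

import Mathlib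

open MeasureTheory Filter Topology
open scoped BoundedContinuousFunction

namespace CondDelta

section Majorants

variable {α : Type*} [MeasurableSpace α]

/-- `U` is a minimal measurable majorant (measurable cover) of the possibly nonmeasurable
function `f` with respect to `μ`. -/
structure IsMinimalMajorant (μ : Measure α) (f U : α → ℝ) : Prop where
  measurable : Measurable U
  le : ∀ x, f x ≤ U x
  minimal : ∀ V : α → ℝ, Measurable V → (∀ᵐ x ∂μ, f x ≤ V x) → ∀ᵐ x ∂μ, U x ≤ V x

/-- A bounded function on a finite measure space has a minimal measurable majorant. -/
theorem exists_isMinimalMajorant (μ : Measure α) [IsFiniteMeasure μ] {f : α → ℝ} {C : ℝ}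
    (hf : ∀ x, |f x| ≤ C) : ∃ U, IsMinimalMajorant μ f U := by
  obtain ⟨g, hgm, hgle, hgeq⟩ :=
    exists_measurable_le_lintegral_eq μ (fun x => ENNReal.ofReal (C - f x))
  have hgtop : ∀ x, g x ≠ ⊤ := fun x => ne_top_of_le_ne_top ENNReal.ofReal_ne_top (hgle x)
  have hint : ∫⁻ x, g x ∂μ ≠ ⊤ := by
    have h1 : ∫⁻ x, g x ∂μ ≤ ∫⁻ _, ENNReal.ofReal (2 * C) ∂μ := by
      refine lintegral_mono fun x => (hgle x).trans (ENNReal.ofReal_le_ofReal ?_)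
      have := abs_le.1 (hf x)
      linarith
    refine ne_top_of_le_ne_top ?_ h1
    rw [lintegral_const]
    exact ENNReal.mul_ne_top ENNReal.ofReal_ne_top (measure_ne_top μ _)
  refine ⟨fun x => C - (g x).toReal, measurable_const.sub hgm.ennreal_toReal, fun x => ?_, ?_⟩
  · have h1 := ENNReal.toReal_mono ENNReal.ofReal_ne_top (hgle x)
    have := abs_le.1 (hf x)
    rw [ENNReal.toReal_ofReal (by linarith)] at h1
    linarith
  · intro V hV hfV
    set k : α → ENNReal := fun x => max (g x) (ENNReal.ofReal (C - V x)) with hk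
    have hkm : Measurable k := hgm.max (measurable_const.sub hV).ennreal_ofReal
    have hkle : ∫⁻ x, k x ∂μ ≤ ∫⁻ x, g x ∂μ := by
      rw [← hgeq]
      refine lintegral_mono_ae ?_
      filter_upwards [hfV] with x hx
      exact max_le (hgle x) (ENNReal.ofReal_le_ofReal (by linarith))
    have hae : g =ᵐ[μ] k :=
      ae_eq_of_ae_le_of_lintegral_le (Eventually.of_forall fun x => le_max_left _ _) hint
        hkm.aemeasurable hkle
    filter_upwards [hae] with x hx
    have h2 : ENNReal.ofReal (C - V x) ≤ g x := by
      rw [hx]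
      exact le_max_right _ _
    have h3 := (ENNReal.ofReal_le_iff_le_toReal (hgtop x)).1 h2
    linarith

open Classical in
/-- The minimal measurable majorant `f^*` with respect to `μ`, unique up to `μ`-null sets. It is
only used for bounded `f` and finite `μ`, where it exists. -/
noncomputable def majorant (μ : Measure α) (f : α → ℝ) : α → ℝ :=
  if h : ∃ U, IsMinimalMajorant μ f U then h.choose else f

theorem isMinimalMajorant_majorant (μ : Measure α) [IsFiniteMeasure μ] {f : α → ℝ} {C : ℝ}
    (hf : ∀ x, |f x| ≤ C) : IsMinimalMajorant μ f (majorant μ f) := by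
  have h := exists_isMinimalMajorant μ hf
  unfold majorant
  rw [dif_pos h]
  exact h.choose_spec

/-- The maximal measurable minorant `f_* = -(-f)^*`. -/
noncomputable def minorant (μ : Measure α) (f : α → ℝ) : α → ℝ :=
  fun x => -majorant μ (fun y => -f y) x

/-- The outer expectation `E^* f = E (f^*)` of a bounded, possibly nonmeasurable function. -/
noncomputable def outerExpectation (μ : Measure α) (f : α → ℝ) : ℝ :=
  ∫ x, majorant μ f x ∂μ

/-- `Y` is a separable Borel measurable random element of the metric space `S`: it is measurable
and concentrated on a separable measurable set. -/
def IsSeparableRandomElement {S : Type*} [TopologicalSpace S] [MeasurableSpace S]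
    (μ : Measure α) (Y : α → S) : Prop :=
  Measurable Y ∧
    ∃ A : Set S, MeasurableSet A ∧ TopologicalSpace.IsSeparable A ∧ ∀ᵐ x ∂μ, Y x ∈ A

end Majorants

section WeakConvergence

/-- The real functions on `S` with bounded Lipschitz norm at most one. -/
def BL₁ (S : Type*) [PseudoMetricSpace S] : Set (S → ℝ) :=
  {h | (∀ x, |h x| ≤ 1) ∧ LipschitzWith 1 h}

/-- Weak convergence `Y n ⇝ Z` of arbitrary maps `Y n`, in terms of outer expectations of bounded
continuous functions. -/
def WeaklyConverges {Ω Ω' S : Type*} [MeasurableSpace Ω] [MeasurableSpace Ω']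
    [PseudoMetricSpace S] (μ : Measure Ω) (Y : ℕ → Ω → S) (ν : Measure Ω') (Z : Ω' → S) : Prop :=
  ∀ f : S →ᵇ ℝ,
    Tendsto (fun n => outerExpectation μ (fun ω => f (Y n ω))) atTop (𝓝 (∫ ω, f (Z ω) ∂ν))

variable {Ω₁ Ω₂ S : Type*} [MeasurableSpace Ω₁] [MeasurableSpace Ω₂] [PseudoMetricSpace S]
  {χ₁ χ₂ : ℕ → Type*}

/-- Weak convergence `y n (X n, M n) ⇝ Y` conditionally on `X n` in outer probability, for
arbitrary maps `X n` and `M n` on the two factors of a product probability space. The conditional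
expectation given `X n` is the integral over the second factor, at a fixed point `ω₁` of the first.

* `tendsto_sup`: `sup_{h ∈ BL₁} |E₂ h(y n (X n, M n))^{2*} - E h(Y)| → 0` in outer probability, the
  majorant being taken with respect to the second variable only, for fixed `ω₁`;
* `asymptotically_measurable`: `E₂ h(y n (X n, M n))^* - E₂ h(y n (X n, M n))_* → 0` in outer
  probability for every `h ∈ BL₁`, the majorant and the minorant being taken jointly in both
  variables.

The functions of `ω₁` need not be measurable. As a measure is applied to arbitrary sets as the
outer measure, `TendstoInMeasure` is convergence in outer probability. -/
structure CondWeaklyConverges (Q₁ : Measure Ω₁) (Q₂ : Measure Ω₂)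
    (X : ∀ n, Ω₁ → χ₁ n) (M : ∀ n, Ω₂ → χ₂ n) (y : ∀ n, χ₁ n → χ₂ n → S)
    (Y : Ω₁ × Ω₂ → S) : Prop where
  tendsto_sup :
    TendstoInMeasure Q₁
      (fun n ω₁ => ⨆ h : BL₁ S,
        |outerExpectation Q₂ (fun ω₂ => h.1 (y n (X n ω₁) (M n ω₂))) -
          ∫ ω, h.1 (Y ω) ∂(Q₁.prod Q₂)|)
      atTop (fun _ => 0)
  asymptotically_measurable : ∀ h ∈ BL₁ S,
    TendstoInMeasure Q₁
      (fun n ω₁ =>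
        (∫ ω₂, majorant (Q₁.prod Q₂) (fun ω => h (y n (X n ω.1) (M n ω.2))) (ω₁, ω₂) ∂Q₂) -
          ∫ ω₂, minorant (Q₁.prod Q₂) (fun ω => h (y n (X n ω.1) (M n ω.2))) (ω₁, ω₂) ∂Q₂)
      atTop (fun _ => 0)

end WeakConvergence

/-- The map `φ`, of which only the values on `Dφ` matter, is uniformly Hadamard differentiable at
`θ ∈ Dφ` tangentially to the subspace `D₀`, with the continuous linear derivative `φ'`. -/
def HasUniformHadamardDerivAt {D E : Type*} [NormedAddCommGroup D] [NormedSpace ℝ D]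
    [NormedAddCommGroup E] [NormedSpace ℝ E] (φ : D → E) (Dφ : Set D) (D₀ : Submodule ℝ D)
    (φ' : D₀ →L[ℝ] E) (θ : D) : Prop :=
  θ ∈ Dφ ∧
    ∀ (t : ℕ → ℝ) (h : ℕ → D) (h₀ : D₀) (ϑ : ℕ → D),
      (∀ n, t n ≠ 0) → Tendsto t atTop (𝓝 0) →
      Tendsto h atTop (𝓝 (h₀ : D)) → Tendsto ϑ atTop (𝓝 θ) →
      (∀ n, ϑ n ∈ Dφ) → (∀ n, ϑ n + t n • h n ∈ Dφ) →
      Tendsto (fun n => (t n)⁻¹ • (φ (ϑ n + t n • h n) - φ (ϑ n))) atTop (𝓝 (φ' h₀))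

end CondDelta

/-! With `t = 1/r n` and base point `ϑ` the value of `Pn`, the map of interest is a difference
quotient of `φ` at `x = r n • (Phat - Pn)`. Near each `z` in `D₀` these quotients, and `φ'` itself,
are within `ε` of `φ' z`, provided `t` is small and `ϑ` is close to `P`
(`HasUniformHadamardDerivAt.exists_pos`). The limit `Ghat` has separable support, so countably many
such balls cover it, and finitely many of them carry all but a small part of its law.

A Lipschitz partition of unity `b i` on these finitely many balls replaces `h` of the quotient, and
`h ∘ φ'`, by the single function `∑ b i * h (φ' (z i)) = L * f` with `f` in `BL₁ D`. The error is at
most `ε + L * v`, where `L * v = 1 - ∑ b i` has small mean under `Ghat`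
(`HasUniformHadamardDerivAt.exists_lipschitz_approx`). As `δ`, `L` and `v` do not depend on `h`, the
assumed convergence over `BL₁ D`, applied to `f` and `v`, gives convergence uniformly over `BL₁ E`.
Neither tightness nor an extension of `φ'` to all of `D` is needed.

The base point is close to `P` in outer probability because `r n • (Pn - Pc n)` converges weakly and
`r n → ∞`. For asymptotic measurability the same comparison is made with joint majorants and
minorants (`ae_abs_majorant_sub_minorant_le`). -/

namespace CondDelta

/-! ### Majorants and outer expectations -/

section Majorants

variable {α : Type*} [MeasurableSpace α] {μ : Measure α} {f g v V : α → ℝ} {C : ℝ}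

theorem le_majorant [IsFiniteMeasure μ] (hf : ∀ x, |f x| ≤ C) (x : α) : f x ≤ majorant μ f x :=
  (isMinimalMajorant_majorant μ hf).le x

theorem measurable_majorant [IsFiniteMeasure μ] (hf : ∀ x, |f x| ≤ C) :
    Measurable (majorant μ f) :=
  (isMinimalMajorant_majorant μ hf).measurable

theorem majorant_ae_le [IsFiniteMeasure μ] (hf : ∀ x, |f x| ≤ C) (hV : Measurable V)
    (h : ∀ x, f x ≤ V x) : ∀ᵐ x ∂μ, majorant μ f x ≤ V x :=
  (isMinimalMajorant_majorant μ hf).minimal V hV (Eventually.of_forall h)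

theorem abs_majorant_ae_le [IsFiniteMeasure μ] (hf : ∀ x, |f x| ≤ C) :
    ∀ᵐ x ∂μ, |majorant μ f x| ≤ C := by
  filter_upwards [majorant_ae_le (μ := μ) hf (measurable_const (a := C))
    fun x => (abs_le.1 (hf x)).2] with x hx
  exact abs_le.2 ⟨(abs_le.1 (hf x)).1.trans (le_majorant hf x), hx⟩

theorem integrable_majorant [IsFiniteMeasure μ] (hf : ∀ x, |f x| ≤ C) :
    Integrable (majorant μ f) μ :=
  Integrable.of_bound (measurable_majorant hf).aestronglyMeasurable C (abs_majorant_ae_le hf)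

theorem minorant_le [IsFiniteMeasure μ] (hf : ∀ x, |f x| ≤ C) (x : α) : minorant μ f x ≤ f x :=
  neg_le.1 (le_majorant (μ := μ) (f := fun y => -f y) (C := C) (by simpa using hf) x)

theorem outerExpectation_le [IsFiniteMeasure μ] (hf : ∀ x, |f x| ≤ C) (hV : Measurable V)
    (hVi : Integrable V μ) (h : ∀ x, f x ≤ V x) : outerExpectation μ f ≤ ∫ x, V x ∂μ :=
  integral_mono_ae (integrable_majorant hf) hVi (majorant_ae_le hf hV h)

theorem abs_outerExpectation_le [IsProbabilityMeasure μ] (hf : ∀ x, |f x| ≤ C) :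
    |outerExpectation μ f| ≤ C := by
  have h := norm_integral_le_of_norm_le_const (μ := μ) (f := majorant μ f) (C := C)
    (abs_majorant_ae_le hf)
  simpa [outerExpectation] using h

/-- Outer expectations of functions that are close, up to a scaling. -/
theorem abs_outerExpectation_sub_le [IsProbabilityMeasure μ] {L c : ℝ} (hL : 0 < L)
    (hf : ∀ x, |f x| ≤ 1) (hg : ∀ x, |g x| ≤ 1) (hv : ∀ x, |v x| ≤ 1)
    (h : ∀ x, |f x - L * g x| ≤ c + L * v x) :
    |outerExpectation μ f - L * outerExpectation μ g| ≤ c + L * outerExpectation μ v := by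
  have mf := measurable_majorant (μ := μ) hf
  have mg := measurable_majorant (μ := μ) hg
  have mv := measurable_majorant (μ := μ) hv
  have jf := integrable_majorant (μ := μ) hf
  have jg := integrable_majorant (μ := μ) hg
  have jv := integrable_majorant (μ := μ) hv
  have h1 : outerExpectation μ f ≤
      ∫ x, (L * majorant μ g x + (c + L * majorant μ v x)) ∂μ := by
    refine outerExpectation_le hf (by fun_prop) (by fun_prop) fun x => ?_
    have h1 := (abs_le.1 (h x)).2
    have h2 := mul_le_mul_of_nonneg_left (le_majorant (μ := μ) hg x) hL.le
    have h3 := mul_le_mul_of_nonneg_left (le_majorant (μ := μ) hv x) hL.le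
    linarith
  -- Outer expectation is only sublinear, so the lower bound needs its own majorant of `g`, built
  -- from those of `f` and `v`.
  have h2 : outerExpectation μ g ≤
      ∫ x, L⁻¹ * (majorant μ f x + (c + L * majorant μ v x)) ∂μ := by
    refine outerExpectation_le hg (by fun_prop) (by fun_prop) fun x => ?_
    have h1 := (abs_le.1 (h x)).1
    have h2 := le_majorant (μ := μ) hf x
    have h3 := mul_le_mul_of_nonneg_left (le_majorant (μ := μ) hv x) hL.le
    rw [le_inv_mul_iff₀ hL]
    linarith
  rw [integral_add (by fun_prop) (by fun_prop), integral_add (by fun_prop) (by fun_prop),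
    integral_const_mul, integral_const_mul] at h1
  rw [integral_const_mul, integral_add (by fun_prop) (by fun_prop),
    integral_add (by fun_prop) (by fun_prop), integral_const_mul, le_inv_mul_iff₀ hL] at h2
  simp only [integral_const, probReal_univ, one_smul] at h1 h2
  unfold outerExpectation at *
  rw [abs_le]
  constructor <;> linarith

end Majorants

/-! ### Convergence in outer probability -/

section Measure

variable {α : Type*} [MeasurableSpace α] {μ : Measure α}

theorem tendstoInMeasure_zero_of_abs_le {Z : ℕ → α → ℝ}
    (h : ∀ ε > 0, ∃ B : ℕ → Set α, Tendsto (fun n => μ (B n)) atTop (𝓝 0) ∧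
      ∀ᶠ n in atTop, ∀ᵐ x ∂μ, x ∉ B n → |Z n x| ≤ ε) :
    TendstoInMeasure μ Z atTop (fun _ => 0) := by
  rw [tendstoInMeasure_iff_dist]
  intro ε hε
  -- The event `ε ≤ |Z n x|` is not strict; halving makes it incompatible with the bound off `B n`.
  obtain ⟨B, hB, hZ⟩ := h (ε / 2) (half_pos hε)
  refine tendsto_of_tendsto_of_tendsto_of_le_of_le' tendsto_const_nhds hB
    (Eventually.of_forall fun n => zero_le) ?_
  filter_upwards [hZ] with n hn
  refine measure_mono_ae (hn.mono fun x hn hx => ?_)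
  by_contra hxB
  have h1 := hn hxB
  have hx : x ∈ {x | ε ≤ dist (Z n x) 0} := hx
  simp only [Set.mem_ofPred_eq, Real.dist_eq, sub_zero] at hx
  linarith

theorem TendstoInMeasure.tendsto_measure_le_abs {Z : ℕ → α → ℝ}
    (h : TendstoInMeasure μ Z atTop (fun _ => 0)) {ε : ℝ} (hε : 0 < ε) :
    Tendsto (fun n => μ {x | ε ≤ |Z n x|}) atTop (𝓝 0) := by
  rw [tendstoInMeasure_iff_dist] at h
  simpa [Real.dist_eq] using h ε hε

theorem tendsto_measure_union_zero {A B : ℕ → Set α}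
    (hA : Tendsto (fun n => μ (A n)) atTop (𝓝 0)) (hB : Tendsto (fun n => μ (B n)) atTop (𝓝 0)) :
    Tendsto (fun n => μ (A n ∪ B n)) atTop (𝓝 0) :=
  tendsto_of_tendsto_of_tendsto_of_le_of_le tendsto_const_nhds (by simpa using hA.add hB)
    (fun _ => zero_le) fun n => measure_union_le (A n) (B n)

/-- An outer version of Markov's inequality. -/
theorem measure_le_outerExpectation [IsProbabilityMeasure μ] {f : α → ℝ} {s : Set α}
    (hf : ∀ x, |f x| ≤ 1) (hf0 : ∀ x, 0 ≤ f x) (hs : ∀ x ∈ s, 1 ≤ f x) :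
    μ s ≤ ENNReal.ofReal (outerExpectation μ f) := by
  have h1 := mul_meas_ge_le_integral_of_nonneg (μ := μ) (f := majorant μ f)
    (Eventually.of_forall fun x => (hf0 x).trans (le_majorant hf x)) (integrable_majorant hf) 1
  rw [one_mul] at h1
  have h2 : μ s ≤ μ {x | 1 ≤ majorant μ f x} :=
    measure_mono fun x hx => (hs x hx).trans (le_majorant hf x)
  refine h2.trans ?_
  rw [← ofReal_measureReal]
  exact ENNReal.ofReal_le_ofReal h1

/-- If `r n • (Y n - c n)` converges weakly, `r n → ∞` and `c n → p`, then `Y n → p` in outer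
probability. -/
theorem WeaklyConverges.tendsto_measure_le_norm_sub {D : Type*} [NormedAddCommGroup D]
    [NormedSpace ℝ D] [MeasurableSpace D] [BorelSpace D] [IsProbabilityMeasure μ]
    {r : ℕ → ℝ} {Y : ℕ → α → D} {c : ℕ → D} {p : D} {G : α → D}
    (hG : Measurable G) (hr : Tendsto r atTop atTop) (hc : Tendsto c atTop (𝓝 p))
    (h : WeaklyConverges μ (fun n x => r n • (Y n x - c n)) μ G) {δ : ℝ} (hδ : 0 < δ) :
    Tendsto (fun n => μ {x | δ ≤ ‖Y n x - p‖}) atTop (𝓝 0) := by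
  -- `F k` vanishes on the ball of radius `k` and equals 1 outside that of radius `k + 1`. Its mean
  -- under `G` tends to zero, while eventually `δ ≤ ‖Y n x - p‖` forces `‖r n • (Y n x - c n)‖ ≥ k +
  -- 1`.
  let F : ℕ → D →ᵇ ℝ := fun k => BoundedContinuousFunction.ofNormedAddCommGroup
    (fun x : D => max 0 (min 1 (‖x‖ - k))) (by fun_prop) 1 (fun x => by
      rw [Real.norm_eq_abs, abs_of_nonneg (le_max_left _ _)]
      exact max_le zero_le_one (min_le_left _ _))
  have hF1 : ∀ k x, |F k x| ≤ 1 := fun k x => by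
    change |max 0 (min 1 (‖x‖ - k))| ≤ 1
    rw [abs_of_nonneg (le_max_left _ _)]
    exact max_le zero_le_one (min_le_left _ _)
  have hlim : Tendsto (fun k => ∫ x, F k (G x) ∂μ) atTop (𝓝 (∫ _, (0 : ℝ) ∂μ)) := by
    refine tendsto_integral_of_dominated_convergence (fun _ => 1)
      (fun k => ((F k).continuous.measurable.comp hG).aestronglyMeasurable)
      (integrable_const _) (fun k => Eventually.of_forall fun x => hF1 k _)
      (Eventually.of_forall fun x => ?_)
    refine tendsto_const_nhds.congr' ?_
    filter_upwards [(tendsto_natCast_atTop_atTop (R := ℝ)).eventually_ge_atTop ‖G x‖] with k hk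
    change 0 = max 0 (min 1 (‖G x‖ - k))
    rw [max_eq_left]
    exact (min_le_right _ _).trans (by linarith)
  rw [integral_zero] at hlim
  rw [ENNReal.tendsto_nhds_zero]
  intro ε hε
  obtain ⟨e, he0, heε⟩ : ∃ e : ℝ, 0 < e ∧ ENNReal.ofReal e ≤ ε := by
    rcases eq_or_ne ε ⊤ with rfl | hε'
    · exact ⟨1, one_pos, le_top⟩
    · exact ⟨ε.toReal, ENNReal.toReal_pos hε.ne' hε', ENNReal.ofReal_toReal hε' |>.le⟩
  obtain ⟨k, hk⟩ := (hlim.eventually_lt_const he0).exists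
  filter_upwards [(h (F k)).eventually_lt_const hk,
    hr.eventually_ge_atTop ((k + 1) / (δ / 2)),
    hc.eventually (Metric.ball_mem_nhds p (half_pos hδ))] with n hn hrn hcn
  refine (measure_le_outerExpectation (f := fun x => F k (r n • (Y n x - c n)))
    (fun x => hF1 k _) (fun x => le_max_left _ _) fun x hx => ?_).trans
    ((ENNReal.ofReal_le_ofReal hn.le).trans heε)
  have hr0 : 0 ≤ r n := le_trans (by positivity) hrn
  rw [dist_eq_norm] at hcn
  have h1 : δ / 2 ≤ ‖Y n x - c n‖ := by
    have := norm_add_le (Y n x - c n) (c n - p)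
    rw [sub_add_sub_cancel] at this
    have hx' : δ ≤ ‖Y n x - p‖ := hx
    linarith
  have h2 : (k + 1 : ℝ) ≤ ‖r n • (Y n x - c n)‖ := by
    rw [norm_smul, Real.norm_of_nonneg hr0]
    rw [div_le_iff₀ (half_pos hδ)] at hrn
    exact hrn.trans (mul_le_mul_of_nonneg_left h1 hr0)
  change 1 ≤ max 0 (min 1 (‖r n • (Y n x - c n)‖ - k))
  exact le_max_of_le_right (le_min le_rfl (by linarith))

end Measure

/-! ### Lipschitz partitions of unity -/

section Bump

variable {S : Type*} [PseudoMetricSpace S]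

/-- The tent function of height `ρ i` on the ball of radius `ρ i` around `z i`. -/
noncomputable def tent (z : ℕ → S) (ρ : ℕ → ℝ) (i : ℕ) (x : S) : ℝ :=
  max 0 (ρ i - dist x (z i))

/-- The sum of the first `m` tent functions, bounded below by `(m + 1)⁻¹`. -/
noncomputable def tentSum (z : ℕ → S) (ρ : ℕ → ℝ) (m : ℕ) (x : S) : ℝ :=
  max (∑ i ∈ Finset.range m, tent z ρ i x) ((m : ℝ) + 1)⁻¹

/-- The `i`-th of `m` Lipschitz functions, which form a partition of unity where the sum of the
tent functions is at least `(m + 1)⁻¹`. -/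
noncomputable def bump (z : ℕ → S) (ρ : ℕ → ℝ) (m i : ℕ) (x : S) : ℝ :=
  tent z ρ i x / tentSum z ρ m x

variable {z : ℕ → S} {ρ : ℕ → ℝ} {m i : ℕ}

theorem tent_nonneg (x : S) : 0 ≤ tent z ρ i x := le_max_left _ _

theorem abs_tent_sub_le (x y : S) : |tent z ρ i x - tent z ρ i y| ≤ dist x y := by
  refine (abs_max_sub_max_le_max _ _ _ _).trans (max_le (by simp) ?_)
  rw [sub_sub_sub_cancel_left, abs_sub_comm]
  exact abs_dist_sub_le x y (z i)

theorem inv_le_tentSum (x : S) : ((m : ℝ) + 1)⁻¹ ≤ tentSum z ρ m x := le_max_right _ _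

theorem tentSum_pos (x : S) : 0 < tentSum z ρ m x :=
  lt_of_lt_of_le (by positivity) (inv_le_tentSum x)

theorem abs_tentSum_sub_le (x y : S) :
    |tentSum z ρ m x - tentSum z ρ m y| ≤ m * dist x y := by
  refine (abs_max_sub_max_le_max _ _ _ _).trans (max_le ?_ (by simp; positivity))
  rw [← Finset.sum_sub_distrib]
  refine (Finset.abs_sum_le_sum_abs _ _).trans
    ((Finset.sum_le_sum fun i _ => abs_tent_sub_le x y).trans ?_)
  simp

theorem bump_nonneg (x : S) : 0 ≤ bump z ρ m i x :=
  div_nonneg (tent_nonneg x) (tentSum_pos x).le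

theorem sum_bump_le_one (x : S) : ∑ i ∈ Finset.range m, bump z ρ m i x ≤ 1 := by
  unfold bump
  rw [← Finset.sum_div, div_le_one (tentSum_pos x)]
  exact le_max_left _ _

theorem dist_lt_of_bump_ne_zero {x : S} (h : bump z ρ m i x ≠ 0) : dist x (z i) < ρ i := by
  contrapose! h
  simp [bump, tent, h]

/-- One tent above the floor already makes the floor inactive. As the floor decreases to zero, every
point of the open ball around `z i` satisfies the hypotheses for all large `m`. -/
theorem sum_bump_eq_one {x : S} (hi : i < m) (h : ((m : ℝ) + 1)⁻¹ ≤ ρ i - dist x (z i)) :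
    ∑ i ∈ Finset.range m, bump z ρ m i x = 1 := by
  unfold bump
  rw [← Finset.sum_div, div_eq_one_iff_eq (tentSum_pos x).ne', tentSum, eq_comm, max_eq_left_iff]
  refine (h.trans (le_max_right _ _)).trans
    (Finset.single_le_sum (f := fun i => tent z ρ i x) (fun _ _ => tent_nonneg x)
      (Finset.mem_range.2 hi))

/-- By the quotient rule, the numerator varies by at most `(m + 1) * dist x y` and the floor bounds
the reciprocal of the denominator by `m + 1`. -/
theorem abs_bump_sub_le (hi : i < m) (x y : S) :
    |bump z ρ m i x - bump z ρ m i y| ≤ ((m : ℝ) + 1) ^ 2 * dist x y := by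
  have hx := tentSum_pos (z := z) (ρ := ρ) (m := m) x
  have hy1 : |bump z ρ m i y| ≤ 1 := by
    rw [abs_of_nonneg (bump_nonneg y)]
    exact (Finset.single_le_sum (f := fun i => bump z ρ m i y) (fun _ _ => bump_nonneg y)
      (Finset.mem_range.2 hi)).trans (sum_bump_le_one y)
  have hy : tent z ρ i y = bump z ρ m i y * tentSum z ρ m y := by
    rw [bump, div_mul_cancel₀ _ (tentSum_pos y).ne']
  have key : bump z ρ m i x - bump z ρ m i y = ((tent z ρ i x - tent z ρ i y) -
      bump z ρ m i y * (tentSum z ρ m x - tentSum z ρ m y)) / tentSum z ρ m x := by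
    rw [hy, bump]
    field_simp
    ring
  have h1 : |(tent z ρ i x - tent z ρ i y) -
      bump z ρ m i y * (tentSum z ρ m x - tentSum z ρ m y)| ≤ (m + 1) * dist x y := by
    have h2 : |bump z ρ m i y * (tentSum z ρ m x - tentSum z ρ m y)| ≤ 1 * (m * dist x y) := by
      rw [abs_mul]
      exact mul_le_mul hy1 (abs_tentSum_sub_le x y) (abs_nonneg _) zero_le_one
    have h3 := abs_sub (tent z ρ i x - tent z ρ i y)
      (bump z ρ m i y * (tentSum z ρ m x - tentSum z ρ m y))
    have h4 := abs_tent_sub_le (z := z) (ρ := ρ) (i := i) x y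
    linarith
  rw [key, abs_div, abs_of_pos hx, div_le_iff₀ hx]
  have h5 : 1 ≤ ((m : ℝ) + 1) * tentSum z ρ m x := by
    rw [← inv_le_iff_one_le_mul₀' (by positivity)]
    exact inv_le_tentSum x
  calc _ ≤ (m + 1) * dist x y * 1 := by simpa using h1
    _ ≤ (m + 1) * dist x y * (((m : ℝ) + 1) * tentSum z ρ m x) := by gcongr
    _ = _ := by ring

theorem abs_sum_bump_mul_sub_le {c : ℕ → ℝ} (hc : ∀ i, |c i| ≤ 1) (x y : S) :
    |∑ i ∈ Finset.range m, bump z ρ m i x * c i - ∑ i ∈ Finset.range m, bump z ρ m i y * c i| ≤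
      ((m : ℝ) + 1) ^ 3 * dist x y := by
  rw [← Finset.sum_sub_distrib]
  have h1 : ∀ i ∈ Finset.range m, |bump z ρ m i x * c i - bump z ρ m i y * c i| ≤
      ((m : ℝ) + 1) ^ 2 * dist x y := fun i hi => by
    rw [← sub_mul, abs_mul]
    exact (mul_le_of_le_one_right (abs_nonneg _) (hc i)).trans
      (abs_bump_sub_le (Finset.mem_range.1 hi) x y)
  refine (Finset.abs_sum_le_sum_abs _ _).trans ((Finset.sum_le_sum h1).trans ?_)
  rw [Finset.sum_const, Finset.card_range, nsmul_eq_mul, pow_succ _ 2]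
  have h2 : 0 ≤ ((m : ℝ) + 1) ^ 2 * dist x y := by positivity
  nlinarith

theorem abs_sum_bump_mul_le {c : ℕ → ℝ} (hc : ∀ i, |c i| ≤ 1) (x : S) :
    |∑ i ∈ Finset.range m, bump z ρ m i x * c i| ≤ 1 := by
  refine (Finset.abs_sum_le_sum_abs _ _).trans
    ((Finset.sum_le_sum fun i _ => ?_).trans (sum_bump_le_one (z := z) (ρ := ρ) (m := m) x))
  rw [abs_mul, abs_of_nonneg (bump_nonneg x)]
  exact mul_le_of_le_one_right (bump_nonneg x) (hc i)

/-- Only bumps whose ball contains `x` contribute to the average of `a - c i`; the mass missing from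
the partition is charged to `|a| ≤ 1`. -/
theorem abs_sub_sum_bump_mul_le {c : ℕ → ℝ} {a ε : ℝ} {x : S} (ha : |a| ≤ 1) (hε : 0 ≤ ε)
    (h : ∀ i < m, dist x (z i) < ρ i → |a - c i| ≤ ε) :
    |a - ∑ i ∈ Finset.range m, bump z ρ m i x * c i| ≤
      ε + (1 - ∑ i ∈ Finset.range m, bump z ρ m i x) := by
  have hs := sum_bump_le_one (z := z) (ρ := ρ) (m := m) x
  have key : a - ∑ i ∈ Finset.range m, bump z ρ m i x * c i =
      ∑ i ∈ Finset.range m, bump z ρ m i x * (a - c i) +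
        (1 - ∑ i ∈ Finset.range m, bump z ρ m i x) * a := by
    simp only [mul_sub, Finset.sum_sub_distrib, ← Finset.sum_mul]
    ring
  rw [key]
  refine (abs_add_le _ _).trans (add_le_add ?_ ?_)
  · have h1 : ∀ i ∈ Finset.range m, |bump z ρ m i x * (a - c i)| ≤ bump z ρ m i x * ε := by
      intro i hi
      rw [abs_mul, abs_of_nonneg (bump_nonneg x)]
      rcases eq_or_ne (bump z ρ m i x) 0 with h0 | h0
      · simp [h0]
      · exact mul_le_mul_of_nonneg_left
          (h i (Finset.mem_range.1 hi) (dist_lt_of_bump_ne_zero h0)) (bump_nonneg x)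
    refine (Finset.abs_sum_le_sum_abs _ _).trans ((Finset.sum_le_sum h1).trans ?_)
    rw [← Finset.sum_mul]
    exact mul_le_of_le_one_left hε hs
  · rw [abs_mul, abs_of_nonneg (by linarith)]
    exact mul_le_of_le_one_right (by linarith) ha

theorem inv_mul_mem_BL₁ {F : S → ℝ} {L : ℝ} (hL : 1 ≤ L) (hF : ∀ x, |F x| ≤ 1)
    (hFL : ∀ x y, |F x - F y| ≤ L * dist x y) : (fun x => L⁻¹ * F x) ∈ BL₁ S := by
  have hL0 : 0 < L := one_pos.trans_le hL
  refine ⟨fun x => ?_, LipschitzWith.of_dist_le_mul fun x y => ?_⟩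
  · rw [abs_mul, abs_of_pos (inv_pos.2 hL0)]
    exact mul_le_one₀ (inv_le_one_of_one_le₀ hL) (abs_nonneg _) (hF x)
  · rw [Real.dist_eq, ← mul_sub, abs_mul, abs_of_pos (inv_pos.2 hL0), inv_mul_le_iff₀ hL0]
    simpa using hFL x y

end Bump

/-! ### Lipschitz approximation of difference quotients -/

section Hadamard

variable {D E : Type*} [NormedAddCommGroup D] [NormedSpace ℝ D]
  [NormedAddCommGroup E] [NormedSpace ℝ E]
  {φ : D → E} {Dφ : Set D} {D₀ : Submodule ℝ D} {φ' : D₀ →L[ℝ] E} {P : D}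

/-- The difference quotients of a uniformly Hadamard differentiable map, and its derivative, are
uniformly close to `φ' z` near `z`. -/
theorem HasUniformHadamardDerivAt.exists_pos (hφ : HasUniformHadamardDerivAt φ Dφ D₀ φ' P)
    (z : D₀) {ε : ℝ} (hε : 0 < ε) : ∃ δ > 0,
      (∀ x : D₀, dist (x : D) z < δ → dist (φ' x) (φ' z) ≤ ε) ∧
      ∀ (t : ℝ) (ϑ x : D), t ≠ 0 → |t| < δ → dist ϑ P < δ → dist x z < δ → ϑ ∈ Dφ →
        ϑ + t • x ∈ Dφ → dist (t⁻¹ • (φ (ϑ + t • x) - φ ϑ)) (φ' z) ≤ ε := by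
  obtain ⟨δ₁, hδ₁, h₁⟩ := Metric.continuous_iff.1 φ'.continuous z ε hε
  obtain ⟨δ₂, hδ₂, h₂⟩ : ∃ δ > 0,
      ∀ (t : ℝ) (ϑ x : D), t ≠ 0 → |t| < δ → dist ϑ P < δ → dist x z < δ → ϑ ∈ Dφ →
        ϑ + t • x ∈ Dφ → dist (t⁻¹ • (φ (ϑ + t • x) - φ ϑ)) (φ' z) ≤ ε := by
    -- Counterexamples for `δ = 1 / (n + 1)` form sequences that contradict the sequential
    -- definition.
    by_contra! hcon
    choose t ϑ x ht0 ht hϑ hx hϑm hxm hbad using fun n : ℕ =>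
      hcon ((n : ℝ) + 1)⁻¹ (by positivity)
    have hlim : Tendsto (fun n : ℕ => ((n : ℝ) + 1)⁻¹) atTop (𝓝 0) := by
      simpa using tendsto_one_div_add_atTop_nhds_zero_nat (𝕜 := ℝ)
    have h := hφ.2 t x z ϑ ht0
      (squeeze_zero_norm (fun n => (ht n).le) hlim)
      (tendsto_iff_dist_tendsto_zero.2
        (squeeze_zero (fun _ => dist_nonneg) (fun n => (hx n).le) hlim))
      (tendsto_iff_dist_tendsto_zero.2
        (squeeze_zero (fun _ => dist_nonneg) (fun n => (hϑ n).le) hlim)) hϑm hxm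
    obtain ⟨n, hn⟩ := (h.eventually (Metric.ball_mem_nhds _ hε)).exists
    exact absurd hn (not_lt.2 (hbad n).le)
  refine ⟨min δ₁ δ₂, lt_min hδ₁ hδ₂, fun x hx => (h₁ x (hx.trans_le (min_le_left _ _))).le,
    fun t ϑ x h0 ht hϑ hx => h₂ t ϑ x h0 (ht.trans_le (min_le_right _ _))
      (hϑ.trans_le (min_le_right _ _)) (hx.trans_le (min_le_right _ _))⟩

/-- Bounded Lipschitz functions of the difference quotients and of the derivative are approximated
by the same multiple of a bounded Lipschitz function, outside a set that is controlled by the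
function `v` and has small probability under a separable limit. -/
theorem HasUniformHadamardDerivAt.exists_lipschitz_approx [MeasurableSpace D] [BorelSpace D]
    {Ω : Type*} [MeasurableSpace Ω] {μ : Measure Ω} [IsProbabilityMeasure μ] {G : Ω → D₀}
    (hφ : HasUniformHadamardDerivAt φ Dφ D₀ φ' P) (hG : IsSeparableRandomElement μ G)
    {ε : ℝ} (hε : 0 < ε) :
    ∃ δ > 0, ∃ L > 0, ∃ v ∈ BL₁ D, L * ∫ ω, v (G ω) ∂μ ≤ ε ∧
      ∀ h ∈ BL₁ E, ∃ f ∈ BL₁ D,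
        (∀ x : D₀, |h (φ' x) - L * f x| ≤ ε + L * v x) ∧
        ∀ (t : ℝ) (ϑ x : D), t ≠ 0 → |t| < δ → dist ϑ P < δ → ϑ ∈ Dφ → ϑ + t • x ∈ Dφ →
          |h (t⁻¹ • (φ (ϑ + t • x) - φ ϑ)) - L * f x| ≤ ε + L * v x := by
  choose ρ hρ hρ₁ hρ₂ using fun z : D₀ => hφ.exists_pos z hε
  obtain ⟨hGm, A, -, hA, hGA⟩ := hG
  -- A separable metric space is Lindelöf, so countably many of the balls cover `A`; `A` is nonempty
  -- as it has full measure, so the centres can be indexed by `ℕ`.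
  obtain ⟨z, hz⟩ : ∃ z : ℕ → D₀, ∀ x ∈ A, ∃ i, dist (x : D) (z i) < ρ (z i) := by
    have := hA.secondCountableTopology
    have hAL : IsLindelof A := isLindelof_iff_lindelofSpace.2 inferInstance
    obtain ⟨T, hTc, -, hT⟩ := hAL.elim_nhds_subcover
      (fun y => Metric.ball y (ρ y)) fun y _ => Metric.ball_mem_nhds y (hρ y)
    have hTne : T.Nonempty := by
      obtain ⟨ω, hω⟩ := hGA.exists
      obtain ⟨y, hy, -⟩ := Set.mem_iUnion₂.1 (hT hω)
      exact ⟨y, hy⟩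
    obtain ⟨z, rfl⟩ := hTc.exists_eq_range hTne
    refine ⟨z, fun x hx => ?_⟩
    obtain ⟨_, ⟨i, rfl⟩, hi⟩ := Set.mem_iUnion₂.1 (hT hx)
    exact ⟨i, hi⟩
  set b : ℕ → ℕ → D → ℝ := bump (fun i => (z i : D)) (fun i => ρ (z i)) with hb
  have hL1 : ∀ m : ℕ, (1 : ℝ) ≤ ((m : ℝ) + 1) ^ 3 := fun m =>
    one_le_pow₀ (by linarith [m.cast_nonneg (α := ℝ)])
  have hw : ∀ m : ℕ, (fun x => (((m : ℝ) + 1) ^ 3)⁻¹ * (1 - ∑ i ∈ Finset.range m, b m i x)) ∈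
      BL₁ D := fun m => by
    refine inv_mul_mem_BL₁ (hL1 m) (fun x => ?_) fun x y => ?_
    · have h1 : ∑ i ∈ Finset.range m, b m i x ≤ 1 := sum_bump_le_one x
      have h2 : 0 ≤ ∑ i ∈ Finset.range m, b m i x := Finset.sum_nonneg fun i _ => bump_nonneg x
      rw [abs_le]
      constructor <;> linarith
    · have := abs_sum_bump_mul_sub_le (z := fun i => (z i : D)) (ρ := fun i => ρ (z i)) (m := m)
        (c := fun _ => 1) (by simp) x y
      rw [sub_sub_sub_cancel_left, abs_sub_comm]
      simpa using this
  have hwm : ∀ m, Measurable fun ω => 1 - ∑ i ∈ Finset.range m, b m i (G ω) := fun m => by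
    have h1 := ((hw m).2.continuous.measurable.comp
      (measurable_subtype_coe.comp hGm)).const_mul (((m : ℝ) + 1) ^ 3)
    have h2 : ((m : ℝ) + 1) ^ 3 ≠ 0 := by positivity
    simpa only [Function.comp_def, mul_inv_cancel_left₀ h2] using h1
  -- Almost surely `G ω` lies in some ball, so the integrand is eventually zero, and it is dominated
  -- by 1.
  have hlim : Tendsto (fun m => ∫ ω, (1 - ∑ i ∈ Finset.range m, b m i (G ω)) ∂μ) atTop
      (𝓝 (∫ _, (0 : ℝ) ∂μ)) := by
    refine tendsto_integral_of_dominated_convergence (fun _ => 1)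
      (fun m => (hwm m).aestronglyMeasurable) (integrable_const _)
      (fun m => Eventually.of_forall fun ω => ?_) ?_
    · have h1 : ∑ i ∈ Finset.range m, b m i (G ω) ≤ 1 := sum_bump_le_one _
      have h2 : 0 ≤ ∑ i ∈ Finset.range m, b m i (G ω) := Finset.sum_nonneg fun i _ => bump_nonneg _
      rw [Real.norm_eq_abs, abs_le]
      constructor <;> linarith
    · filter_upwards [hGA] with ω hω
      obtain ⟨i, hi⟩ := hz _ hω
      refine tendsto_const_nhds.congr' ?_
      have h0 : Tendsto (fun n : ℕ => ((n : ℝ) + 1)⁻¹) atTop (𝓝 0) := by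
        simpa using tendsto_one_div_add_atTop_nhds_zero_nat (𝕜 := ℝ)
      filter_upwards [h0.eventually_lt_const (sub_pos.2 hi), eventually_gt_atTop i] with m hm him
      exact (sub_eq_zero.2 (sum_bump_eq_one him hm.le).symm).symm
  rw [integral_zero] at hlim
  obtain ⟨m, hm⟩ := (hlim.eventually_lt_const hε).exists
  obtain ⟨δ, hδ, hδρ⟩ : ∃ δ > 0, ∀ i < m, δ ≤ ρ (z i) := by
    have h1 : ∀ᶠ δ in 𝓝[>] (0 : ℝ), ∀ i ∈ Finset.range m, δ ≤ ρ (z i) :=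
      (eventually_all_finset _).2 fun i _ =>
        nhdsWithin_le_nhds (eventually_le_nhds (hρ (z i)))
    obtain ⟨δ, h2, h3⟩ := (h1.and self_mem_nhdsWithin).exists
    exact ⟨δ, h3, fun i hi => h2 i (Finset.mem_range.2 hi)⟩
  have hL0 : 0 < ((m : ℝ) + 1) ^ 3 := by positivity
  -- `L = (m + 1) ^ 3` is the Lipschitz constant of a combination of `m` bumps with coefficients in
  -- `[-1, 1]`.
  refine ⟨δ, hδ, _, hL0, _, hw m, ?_, fun h hh =>
    ⟨fun x => (((m : ℝ) + 1) ^ 3)⁻¹ * ∑ i ∈ Finset.range m, b m i x * h (φ' (z i)),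
      inv_mul_mem_BL₁ (hL1 m) (abs_sum_bump_mul_le fun i => hh.1 _)
        (abs_sum_bump_mul_sub_le fun i => hh.1 _), fun x => ?_, fun t ϑ x h0 ht hϑ hm1 hm2 => ?_⟩⟩
  · rw [integral_const_mul, mul_inv_cancel_left₀ hL0.ne']
    exact hm.le
  · rw [mul_inv_cancel_left₀ hL0.ne', mul_inv_cancel_left₀ hL0.ne']
    refine abs_sub_sum_bump_mul_le (hh.1 _) hε.le fun i _ hi => ?_
    exact (hh.2.dist_le_mul _ _).trans (by simpa using hρ₁ (z i) x hi)
  · rw [mul_inv_cancel_left₀ hL0.ne', mul_inv_cancel_left₀ hL0.ne']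
    refine abs_sub_sum_bump_mul_le (hh.1 _) hε.le fun i him hi => ?_
    refine (hh.2.dist_le_mul _ _).trans ?_
    simpa using hρ₂ (z i) t ϑ x h0 (ht.trans_le (hδρ i him)) (hϑ.trans_le (hδρ i him)) hi hm1 hm2

end Hadamard

/-! ### Sections of joint majorants -/

section Product

variable {Ω₁ Ω₂ : Type*} [MeasurableSpace Ω₁] [MeasurableSpace Ω₂]
  {Q₁ : Measure Ω₁} [IsProbabilityMeasure Q₁] {Q₂ : Measure Ω₂} [IsProbabilityMeasure Q₂]

theorem ae_integrable_majorant_section {f : Ω₁ × Ω₂ → ℝ} {C : ℝ} (hf : ∀ ω, |f ω| ≤ C) :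
    ∀ᵐ ω₁ ∂Q₁, Integrable (fun ω₂ => majorant (Q₁.prod Q₂) f (ω₁, ω₂)) Q₂ := by
  filter_upwards [Measure.ae_ae_of_ae_prod (abs_majorant_ae_le (μ := Q₁.prod Q₂) hf)] with ω₁ h
  exact Integrable.of_bound ((measurable_majorant hf).comp
    measurable_prodMk_left).aestronglyMeasurable C h

/-- The section of a joint minorant lies below the majorant of the section. -/
theorem ae_integral_minorant_section_le {f : Ω₁ × Ω₂ → ℝ} {C : ℝ} (hf : ∀ ω, |f ω| ≤ C) :
    ∀ᵐ ω₁ ∂Q₁, ∫ ω₂, minorant (Q₁.prod Q₂) f (ω₁, ω₂) ∂Q₂ ≤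
      outerExpectation Q₂ (fun ω₂ => f (ω₁, ω₂)) := by
  filter_upwards [ae_integrable_majorant_section (Q₁ := Q₁) (Q₂ := Q₂) (f := fun ω => -f ω)
    (C := C) (by simpa using hf)] with ω₁ h
  exact integral_mono h.neg (integrable_majorant fun ω₂ => hf _) fun ω₂ =>
    (minorant_le hf _).trans (le_majorant (μ := Q₂) (f := fun ω₂ => f (ω₁, ω₂))
      (fun ω₂ => hf _) ω₂)

/-- Setting the right-hand side to 1 over `B` gives a jointly measurable majorant of `f`; minimality
holds almost everywhere on the product and passes to almost every section by Fubini. -/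
theorem ae_majorant_section_le {f g v : Ω₁ × Ω₂ → ℝ} {L c : ℝ} {B : Set Ω₁} (hL : 0 < L)
    (hB : MeasurableSet B) (hf : ∀ ω, |f ω| ≤ 1) (hg : ∀ ω, |g ω| ≤ 1) (hv : ∀ ω, |v ω| ≤ 1)
    (h : ∀ ω, ω.1 ∉ B → f ω ≤ L * g ω + (c + L * v ω)) :
    ∀ᵐ ω₁ ∂Q₁, ω₁ ∉ B → ∫ ω₂, majorant (Q₁.prod Q₂) f (ω₁, ω₂) ∂Q₂ ≤
      L * ∫ ω₂, majorant (Q₁.prod Q₂) g (ω₁, ω₂) ∂Q₂ +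
        (c + L * ∫ ω₂, majorant (Q₁.prod Q₂) v (ω₁, ω₂) ∂Q₂) := by
  classical
  have mg := measurable_majorant (μ := Q₁.prod Q₂) hg
  have mv := measurable_majorant (μ := Q₁.prod Q₂) hv
  have hV : ∀ᵐ ω ∂(Q₁.prod Q₂), majorant (Q₁.prod Q₂) f ω ≤ if ω.1 ∈ B then 1 else
      L * majorant (Q₁.prod Q₂) g ω + (c + L * majorant (Q₁.prod Q₂) v ω) := by
    refine majorant_ae_le hf (Measurable.ite (measurable_fst hB) measurable_const
      (by fun_prop)) fun ω => ?_
    split_ifs with hω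
    · exact (abs_le.1 (hf ω)).2
    · refine (h ω hω).trans ?_
      gcongr
      · exact le_majorant hg ω
      · exact le_majorant hv ω
  filter_upwards [Measure.ae_ae_of_ae_prod hV, ae_integrable_majorant_section (Q₁ := Q₁) (Q₂ := Q₂) hf,
    ae_integrable_majorant_section (Q₁ := Q₁) (Q₂ := Q₂) hg,
    ae_integrable_majorant_section (Q₁ := Q₁) (Q₂ := Q₂) hv] with ω₁ h1 jf jg jv hω
  have h2 := integral_mono_ae (μ := Q₂) jf
    ((jg.const_mul L).add ((integrable_const c).add (jv.const_mul L))) (by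
      filter_upwards [h1] with ω₂ h3
      rwa [if_neg hω] at h3)
  simp only [Pi.add_apply] at h2
  rw [integral_add (by fun_prop) (by fun_prop), integral_add (by fun_prop) (by fun_prop),
    integral_const_mul, integral_const_mul] at h2
  simpa using h2

/-- The one-sided bound is applied to `f` and to `-f`. This leaves the joint majorant of `v`, whose
sections may exceed the majorants of the sections; it is split into its gap to the minorant plus the
minorant, which the sectional outer expectation dominates. -/
theorem ae_abs_majorant_sub_minorant_le {f g v : Ω₁ × Ω₂ → ℝ} {L c : ℝ} {B : Set Ω₁}
    (hL : 0 < L) (hB : MeasurableSet B) (hf : ∀ ω, |f ω| ≤ 1) (hg : ∀ ω, |g ω| ≤ 1)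
    (hv : ∀ ω, |v ω| ≤ 1) (h : ∀ ω, ω.1 ∉ B → |f ω - L * g ω| ≤ c + L * v ω) :
    ∀ᵐ ω₁ ∂Q₁, ω₁ ∉ B →
      |∫ ω₂, majorant (Q₁.prod Q₂) f (ω₁, ω₂) ∂Q₂ - ∫ ω₂, minorant (Q₁.prod Q₂) f (ω₁, ω₂) ∂Q₂| ≤
        2 * c + L * |∫ ω₂, majorant (Q₁.prod Q₂) g (ω₁, ω₂) ∂Q₂ -
            ∫ ω₂, minorant (Q₁.prod Q₂) g (ω₁, ω₂) ∂Q₂| +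
          2 * L * (|∫ ω₂, majorant (Q₁.prod Q₂) v (ω₁, ω₂) ∂Q₂ -
            ∫ ω₂, minorant (Q₁.prod Q₂) v (ω₁, ω₂) ∂Q₂| +
              outerExpectation Q₂ (fun ω₂ => v (ω₁, ω₂))) := by
  have hf' : ∀ ω, |-f ω| ≤ 1 := by simpa using hf
  have hg' : ∀ ω, |-g ω| ≤ 1 := by simpa using hg
  filter_upwards [
    ae_majorant_section_le (Q₁ := Q₁) (Q₂ := Q₂) (c := c) hL hB hf hg hv fun ω hω => by
      have := (abs_le.1 (h ω hω)).2
      linarith,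
    ae_majorant_section_le (Q₁ := Q₁) (Q₂ := Q₂) (c := c) hL hB hf' hg' hv fun ω hω => by
      have := (abs_le.1 (h ω hω)).1
      linarith,
    ae_integral_minorant_section_le (Q₁ := Q₁) (Q₂ := Q₂) hv,
    ae_integrable_majorant_section (Q₁ := Q₁) (Q₂ := Q₂) hf,
    ae_integrable_majorant_section (Q₁ := Q₁) (Q₂ := Q₂) hf'] with ω₁ h1 h2 h3 jf jf' hω
  have h4 : ∫ ω₂, minorant (Q₁.prod Q₂) f (ω₁, ω₂) ∂Q₂ ≤
      ∫ ω₂, majorant (Q₁.prod Q₂) f (ω₁, ω₂) ∂Q₂ :=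
    integral_mono jf'.neg jf fun ω₂ => (minorant_le hf _).trans (le_majorant hf _)
  have h5 := mul_le_mul_of_nonneg_left (le_abs_self
    (∫ ω₂, majorant (Q₁.prod Q₂) g (ω₁, ω₂) ∂Q₂ -
      ∫ ω₂, minorant (Q₁.prod Q₂) g (ω₁, ω₂) ∂Q₂)) hL.le
  have h6 := mul_le_mul_of_nonneg_left (le_abs_self
    (∫ ω₂, majorant (Q₁.prod Q₂) v (ω₁, ω₂) ∂Q₂ -
      ∫ ω₂, minorant (Q₁.prod Q₂) v (ω₁, ω₂) ∂Q₂)) hL.le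
  have h7 := mul_le_mul_of_nonneg_left h3 hL.le
  specialize h1 hω
  specialize h2 hω
  rw [abs_of_nonneg (sub_nonneg.2 h4)]
  simp only [minorant, integral_neg] at *
  linarith

end Product

/-! ### Suprema over bounded Lipschitz functions -/

section BoundedLipschitz

variable {S : Type*} [PseudoMetricSpace S] {Ω Ω' : Type*} [MeasurableSpace Ω] [MeasurableSpace Ω']
  {μ : Measure Ω} {ν : Measure Ω'}

theorem abs_integral_le_one [IsProbabilityMeasure μ] {f : Ω → ℝ} (hf : ∀ ω, |f ω| ≤ 1) : |∫ ω, f ω ∂μ| ≤ 1 := by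
  simpa using norm_integral_le_of_norm_le_const (μ := μ) (f := f) (C := 1)
    (Eventually.of_forall hf)

theorem le_iSup_BL₁ [IsProbabilityMeasure μ] [IsProbabilityMeasure ν]
    (Y : Ω → S) (Z : Ω' → S) {h : S → ℝ} (hh : h ∈ BL₁ S) :
    |outerExpectation μ (fun ω => h (Y ω)) - ∫ ω, h (Z ω) ∂ν| ≤
      ⨆ h : BL₁ S, |outerExpectation μ (fun ω => h.1 (Y ω)) - ∫ ω, h.1 (Z ω) ∂ν| := by
  -- The bound 2 matters: a real supremum over an unbounded family is 0 by default.
  refine le_ciSup (f := fun h : BL₁ S =>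
    |outerExpectation μ (fun ω => h.1 (Y ω)) - ∫ ω, h.1 (Z ω) ∂ν|) ⟨1 + 1, ?_⟩ ⟨h, hh⟩
  rintro _ ⟨k, rfl⟩
  exact (abs_sub _ _).trans (add_le_add (abs_outerExpectation_le fun ω => k.2.1 _)
    (abs_integral_le_one fun ω => k.2.1 _))

theorem abs_iSup_BL₁_le (Y : Ω → S) (Z : Ω' → S) {c : ℝ} (hc : ∀ h ∈ BL₁ S,
      |outerExpectation μ (fun ω => h (Y ω)) - ∫ ω, h (Z ω) ∂ν| ≤ c) :
    |(⨆ h : BL₁ S, |outerExpectation μ (fun ω => h.1 (Y ω)) - ∫ ω, h.1 (Z ω) ∂ν|)| ≤ c := by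
  have : Nonempty (BL₁ S) := ⟨fun _ => 0, by simp, LipschitzWith.const' 0⟩
  rw [abs_of_nonneg (Real.iSup_nonneg fun _ => abs_nonneg _)]
  exact ciSup_le fun h => hc h.1 h.2

theorem abs_integral_sub_le [IsProbabilityMeasure μ] {f g v : Ω → ℝ} {L c : ℝ} (hf : Integrable f μ)
    (hg : Integrable g μ) (hv : Integrable v μ) (h : ∀ ω, |f ω - L * g ω| ≤ c + L * v ω) :
    |∫ ω, f ω ∂μ - L * ∫ ω, g ω ∂μ| ≤ c + L * ∫ ω, v ω ∂μ := by
  have h1 : |∫ ω, (f ω - L * g ω) ∂μ| ≤ ∫ ω, (c + L * v ω) ∂μ :=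
    (abs_integral_le_integral_abs).trans (integral_mono (by fun_prop) (by fun_prop) h)
  rw [integral_sub (by fun_prop) (by fun_prop), integral_add (by fun_prop) (by fun_prop),
    integral_const_mul, integral_const_mul] at h1
  simpa using h1

end BoundedLipschitz

end CondDelta

/-! ### The conditional delta-method -/

theorem theorem3p2
    {D E : Type*} [NormedAddCommGroup D] [NormedSpace ℝ D] [MeasurableSpace D] [BorelSpace D]
    [NormedAddCommGroup E] [NormedSpace ℝ E]
    {Ω₁ Ω₂ : Type*} [MeasurableSpace Ω₁] [MeasurableSpace Ω₂]
    (Q₁ : Measure Ω₁) [IsProbabilityMeasure Q₁] (Q₂ : Measure Ω₂) [IsProbabilityMeasure Q₂]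
    {χ₁ χ₂ : ℕ → Type*} (X : ∀ n, Ω₁ → χ₁ n) (M : ∀ n, Ω₂ → χ₂ n)
    (φ : D → E) (Dφ : Set D) (D₀ : Submodule ℝ D) (φ' : D₀ →L[ℝ] E) (P : D)
    (hφ : CondDelta.HasUniformHadamardDerivAt φ Dφ D₀ φ' P)
    (r : ℕ → ℝ) (hr : Tendsto r atTop atTop)
    (Pc : ℕ → D) (hPc_mem : ∀ n, Pc n ∈ Dφ) (hPc : Tendsto Pc atTop (𝓝 P))
    (Pn : ∀ n, χ₁ n → D) (hPn_mem : ∀ n ω₁, Pn n (X n ω₁) ∈ Dφ)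
    (G : Ω₁ → D₀) (hG : CondDelta.IsSeparableRandomElement Q₁ G)
    (hPnG : CondDelta.WeaklyConverges Q₁ (fun n ω₁ => r n • (Pn n (X n ω₁) - Pc n))
      Q₁ (fun ω₁ => (G ω₁ : D)))
    (Phat : ∀ n, χ₁ n → χ₂ n → D) (hPhat_mem : ∀ n ω₁ ω₂, Phat n (X n ω₁) (M n ω₂) ∈ Dφ)
    (Ghat : Ω₁ × Ω₂ → D₀) (hGhat : CondDelta.IsSeparableRandomElement (Q₁.prod Q₂) Ghat)
    (hPhatG : CondDelta.CondWeaklyConverges Q₁ Q₂ X M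
      (fun n x m => r n • (Phat n x m - Pn n x)) (fun ω => (Ghat ω : D))) :
    CondDelta.CondWeaklyConverges Q₁ Q₂ X M
      (fun n x m => r n • (φ (Phat n x m) - φ (Pn n x))) (fun ω => φ' (Ghat ω)) := by
  open CondDelta in
  have hfar : ∀ δ > 0, Tendsto (fun n => Q₁ {ω₁ | δ ≤ ‖Pn n (X n ω₁) - P‖}) atTop (𝓝 0) :=
    fun δ hδ => WeaklyConverges.tendsto_measure_le_norm_sub
      (measurable_subtype_coe.comp hG.1) hr hPc hPnG hδ
  have hrδ : ∀ δ > 0, ∀ᶠ n in atTop, 0 < r n ∧ |(r n)⁻¹| < δ := fun δ hδ => by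
    filter_upwards [hr.eventually_gt_atTop 0,
      (tendsto_inv_atTop_zero.comp hr).eventually_lt_const hδ] with n h1 h2
    exact ⟨h1, by rwa [abs_of_pos (inv_pos.2 h1)]⟩
  have hquot : ∀ {δ ε L : ℝ} {v f : D → ℝ} {h : E → ℝ},
      (∀ (t : ℝ) (ϑ x : D), t ≠ 0 → |t| < δ → dist ϑ P < δ → ϑ ∈ Dφ → ϑ + t • x ∈ Dφ →
          |h (t⁻¹ • (φ (ϑ + t • x) - φ ϑ)) - L * f x| ≤ ε + L * v x) →
      ∀ n, 0 < r n → |(r n)⁻¹| < δ → ∀ ω₁ ω₂, ‖Pn n (X n ω₁) - P‖ < δ →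
        |h (r n • (φ (Phat n (X n ω₁) (M n ω₂)) - φ (Pn n (X n ω₁)))) -
          L * f (r n • (Phat n (X n ω₁) (M n ω₂) - Pn n (X n ω₁)))| ≤
        ε + L * v (r n • (Phat n (X n ω₁) (M n ω₂) - Pn n (X n ω₁))) := by
    intro δ ε L v f h hh n hn hnδ ω₁ ω₂ hω
    have h1 : Pn n (X n ω₁) + (r n)⁻¹ • r n • (Phat n (X n ω₁) (M n ω₂) - Pn n (X n ω₁)) =
        Phat n (X n ω₁) (M n ω₂) := by
      rw [inv_smul_smul₀ hn.ne', add_sub_cancel]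
    have h2 := hh (r n)⁻¹ (Pn n (X n ω₁))
      (r n • (Phat n (X n ω₁) (M n ω₂) - Pn n (X n ω₁))) (inv_ne_zero hn.ne') hnδ
      (by rwa [dist_eq_norm]) (hPn_mem n ω₁) (by rw [h1]; exact hPhat_mem n ω₁ ω₂)
    rwa [h1, inv_inv] at h2
  have hint : ∀ f ∈ BL₁ D, Integrable (fun ω => f (Ghat ω)) (Q₁.prod Q₂) := fun f hf =>
    Integrable.of_bound (hf.2.continuous.measurable.comp
      (measurable_subtype_coe.comp hGhat.1)).aestronglyMeasurable 1
      (Eventually.of_forall fun ω => hf.1 _)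
  have hint' : ∀ h ∈ BL₁ E, Integrable (fun ω => h (φ' (Ghat ω))) (Q₁.prod Q₂) := fun h hh =>
    Integrable.of_bound ((hh.2.continuous.comp φ'.continuous).measurable.comp
      hGhat.1).aestronglyMeasurable 1 (Eventually.of_forall fun ω => hh.1 _)
  constructor
  · refine tendstoInMeasure_zero_of_abs_le fun ε hε => ?_
    -- The six parts of `ε`: one for replacing `h` by `L * f` under each of the two laws, one for
    -- the convergence at `f`, one for `L` times the mean of `v` under `Ghat`, and two for its outer
    -- expectation under `Q₂`.
    obtain ⟨δ, hδ, L, hL, v, hv, hvG, happ⟩ :=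
      hφ.exists_lipschitz_approx hGhat (ε := ε / 6) (by positivity)
    refine ⟨_, tendsto_measure_union_zero (hfar δ hδ)
      (TendstoInMeasure.tendsto_measure_le_abs hPhatG.tendsto_sup
        (ε := ε / (6 * L)) (by positivity)), ?_⟩
    filter_upwards [hrδ δ hδ] with n hn
    refine Eventually.of_forall fun ω₁ hω => ?_
    simp only [Set.mem_union, Set.mem_ofPred_eq, not_or, not_le] at hω
    obtain ⟨hω1, hω2⟩ := hω
    have hS := (le_abs_self _).trans_lt hω2
    refine abs_iSup_BL₁_le _ _ fun h hh => ?_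
    obtain ⟨f, hf, hf1, hf2⟩ := happ h hh
    have h1 := abs_outerExpectation_sub_le (μ := Q₂) hL (fun ω₂ => hh.1 _) (fun ω₂ => hf.1 _)
      (fun ω₂ => hv.1 _) fun ω₂ => hquot hf2 n hn.1 hn.2 ω₁ ω₂ hω1
    have h2 := abs_integral_sub_le (hint' h hh) (hint f hf) (hint v hv) fun ω => hf1 (Ghat ω)
    have h3 := (le_iSup_BL₁ (μ := Q₂) (ν := Q₁.prod Q₂)
      (fun ω₂ => r n • (Phat n (X n ω₁) (M n ω₂) - Pn n (X n ω₁)))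
      (fun ω => (Ghat ω : D)) hf).trans_lt hS
    have h4 := (le_iSup_BL₁ (μ := Q₂) (ν := Q₁.prod Q₂)
      (fun ω₂ => r n • (Phat n (X n ω₁) (M n ω₂) - Pn n (X n ω₁)))
      (fun ω => (Ghat ω : D)) hv).trans_lt hS
    have hscale : ∀ a : ℝ, |a| < ε / (6 * L) → |L * a| < ε / 6 := fun a ha => by
      rw [abs_mul, abs_of_pos hL]
      calc L * |a| < L * (ε / (6 * L)) := by gcongr
        _ = ε / 6 := by field_simp
    have h3' := abs_lt.1 (hscale _ h3)
    have h4' := abs_lt.1 (hscale _ h4)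
    rw [abs_le] at h1 h2 ⊢
    constructor <;> linarith
  · intro h hh
    refine tendstoInMeasure_zero_of_abs_le fun ε hε => ?_
    -- Nine parts of `ε` are used: two from `2 * c`, one from the gap of `f`, and twice three from
    -- `v`, namely its gap, its mean under `Ghat` and the distance to that mean.
    obtain ⟨δ, hδ, L, hL, v, hv, hvG, happ⟩ :=
      hφ.exists_lipschitz_approx hGhat (ε := ε / 10) (by positivity)
    obtain ⟨f, hf, hf1, hf2⟩ := happ h hh
    have hε' : 0 < ε / (10 * L) := by positivity
    -- Joint majorants require a measurable exceptional set; the measurable hull has the same outer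
    -- measure. The supremum part worked at fixed `ω₁` and did not need this.
    set B : ℕ → Set Ω₁ := fun n => toMeasurable Q₁ {ω₁ | δ ≤ ‖Pn n (X n ω₁) - P‖} with hB
    have hBlim : Tendsto (fun n => Q₁ (B n)) atTop (𝓝 0) := by
      simpa only [hB, measure_toMeasurable] using hfar δ hδ
    have hsup := TendstoInMeasure.tendsto_measure_le_abs hPhatG.tendsto_sup hε'
    have hasymp := fun k hk => TendstoInMeasure.tendsto_measure_le_abs
      (hPhatG.asymptotically_measurable k hk) hε'
    refine ⟨_, tendsto_measure_union_zero hBlim (tendsto_measure_union_zero hsup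
      (tendsto_measure_union_zero (hasymp f hf) (hasymp v hv))), ?_⟩
    filter_upwards [hrδ δ hδ] with n hn
    have hBn : ∀ ω₁ ∉ B n, ‖Pn n (X n ω₁) - P‖ < δ := fun ω₁ hω =>
      not_le.1 fun h1 => hω (subset_toMeasurable _ _ h1)
    filter_upwards [ae_abs_majorant_sub_minorant_le (Q₁ := Q₁) (Q₂ := Q₂) hL
      (measurableSet_toMeasurable _ _) (fun ω => hh.1 _) (fun ω => hf.1 _) (fun ω => hv.1 _)
      (fun ω hω => hquot hf2 n hn.1 hn.2 ω.1 ω.2 (hBn ω.1 hω))] with ω₁ h1 hω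
    simp only [Set.mem_union, Set.mem_ofPred_eq, not_or, not_le] at hω
    obtain ⟨hω1, hω2, hω3, hω4⟩ := hω
    have h2 := (le_iSup_BL₁ (μ := Q₂) (ν := Q₁.prod Q₂)
      (fun ω₂ => r n • (Phat n (X n ω₁) (M n ω₂) - Pn n (X n ω₁)))
      (fun ω => (Ghat ω : D)) hv).trans_lt ((le_abs_self _).trans_lt hω2)
    have hscale : ∀ a : ℝ, a < ε / (10 * L) → L * a < ε / 10 := fun a ha => by
      calc L * a < L * (ε / (10 * L)) := by gcongr
        _ = ε / 10 := by field_simp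
    have h3 := hscale _ hω3
    have h4 := hscale _ hω4
    have h5 := hscale _ ((le_abs_self _).trans_lt h2)
    refine (h1 hω1).trans ?_
    linarith
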